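/- For a finite graph $H$ with at least three vertices let $$m_2(H)=\max_{H'\subseteq H,\ v(H')\ge 3}\frac{e(H')-1}{v(H')-2},$$ where $v$ and $e$ count vertices and edges. For graphs $G,T,H$ let $ex(G,T,H)$ be the maximum number of (not necessarily induced, unlabelled) copies of $T$ in an $H$-free subgraph of $G$. Let $G(n,p)$ be the binomial random graph on $n$ vertices in which each edge is present independently with probability $p$. **Theorem 1.4.** Let $m\ge 3$ be an integer and let $c<m_2(K_m)$ be real. There are $M=M(m,c)\in\mathbb N$ and $\delta=\delta(m,c)>0$ such that the following holds. Let $H$ be a finite graph with $\chi(H)=m+1$ and $m_2(H)<c$ which has a subgraph $H_0\subseteq H$ with $\frac{e(H_0)-1}{v(H_0)-2}=m_2(H)$ and $v(H_0)>M$. Let $p=p(n)\in[0,1]$ satisfy $p\le n^{-\frac1{m_2(H)}+\delta}$ for all sufficiently large $n$ and $\binom nm p^{\binom m2}\to\infty$ as $n\to\infty$. Then, w.h.p., $$ex(G(n,p),K_m,H)=(1+o(1))\binom nm p^{\binom m2},$$ that is, for every $\varepsilon>0$ the probability that $\left|ex(G(n,p),K_m,H)-\binom nm p^{\binom m2}\right|\le\varepsilon\binom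 nm p^{\binom m2}$ tends to $1$ as $n\to\infty$. -/

import Mathlib

open Filter Topology MeasureTheory

noncomputable section

namespace RandomTuran

/-- The set of values `(e(H') - 1) / (v(H') - 2)` over the (not necessarily induced) subgraphs `H'`
of `H` with at least three vertices. -/
def twoDensityValues {V : Type*} (H : SimpleGraph V) : Set ℝ :=
  {x | ∃ H' : H.Subgraph, 3 ≤ H'.verts.ncard ∧
    x = ((H'.edgeSet.ncard : ℝ) - 1) / ((H'.verts.ncard : ℝ) - 2)}

/-- The 2-density `m₂(H)`, the maximum of `(e(H') - 1) / (v(H') - 2)` over all subgraphs `H'` of `H`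
with at least three vertices. For finite `H` with at least three vertices this maximum is attained,
see `isGreatest_twoDensity`. -/
def twoDensity {V : Type*} (H : SimpleGraph V) : ℝ :=
  sSup (twoDensityValues H)

theorem isGreatest_twoDensity {V : Type*} [Fintype V] (H : SimpleGraph V)
    (hV : 3 ≤ Fintype.card V) : IsGreatest (twoDensityValues H) (twoDensity H) := by
  have hfin : (twoDensityValues H).Finite := by
    refine (Set.finite_range fun H' : H.Subgraph =>
      ((H'.edgeSet.ncard : ℝ) - 1) / ((H'.verts.ncard : ℝ) - 2)).subset ?_
    rintro x ⟨H', -, rfl⟩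
    exact ⟨H', rfl⟩
  have hne : (twoDensityValues H).Nonempty :=
    ⟨_, ⊤, by simpa [Set.ncard_univ, Nat.card_eq_fintype_card] using hV, rfl⟩
  exact ⟨hne.csSup_mem hfin, fun x hx => le_csSup hfin.bddAbove hx⟩

open Classical in
/-- `ex(G, T, H)`: the maximum number of (unlabelled, not necessarily induced) copies of `T` in an
`H`-free subgraph of `G`. Removing vertices never creates copies, so spanning subgraphs `G' ≤ G`
suffice. -/
def maxCopies {U W V : Type*} [Fintype U] (G : SimpleGraph U) (T : SimpleGraph W)
    (H : SimpleGraph V) : ℕ :=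
  (Finset.univ.filter fun G' : SimpleGraph U => G' ≤ G ∧ H.Free G').sup fun G' => G'.copyCount T

/-- `X(G(n, p)) = (1 + o(1)) f(n)` with high probability, where `p = p(n)`: for each `ε > 0`, the
probability that `|X(G) - f(n)| ≤ ε f(n)` for `G ∼ G(n, p(n))` tends to `1`. -/
def WhpAsymp (p : ℕ → unitInterval) (X : ∀ n : ℕ, SimpleGraph (Fin n) → ℝ) (f : ℕ → ℝ) : Prop :=
  ∀ ε : ℝ, 0 < ε →
    Tendsto (fun n : ℕ => (SimpleGraph.binomialRandom (Fin n) (p n)).real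
      {G : SimpleGraph (Fin n) | |X n G - f n| ≤ ε * f n}) atTop (𝓝 1)

end RandomTuran

end

/-! The upper bound is free: an `H`-free subgraph of `G` has at most as many `m`-cliques as `G`, and
that number is concentrated by the second moment method (`tendsto_measure_card_cliques_far`). For
the lower bound, keep exactly the edges of `G` that lie in `m`-cliques. No clique is lost, so it
suffices that this graph is `H`-free w.h.p.

Write `μ = m₂(H)` and `y = 1/μ - δ`, so that `p ≤ n^(-y)`. If the graph contains `H`, choose an
`m`-clique through each edge of the copy of `H₀`, and let `F` be the union of these boundedly many
cliques. For `H₀` itself, `v - y e = 2 - 1/μ + δ e`. Adding the cliques lowers `v - y e` by at least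
`ε` per edge of `H₀` (`card_endpoints_union_cliques_le`): the cliques have 2-density `(m+1)/2 > c >
μ`, while all nonempty edge sets of `H₀` satisfy `e ≤ μ (v - 2) + 1`. As `H₀` is large, the gain `ε
e` outweighs everything else and `v(F) + 1 ≤ y e(F)` (`exists_dense_of_copy`). By a first moment
bound, such an `F` of bounded size appears with probability `O(1/n)`
(`binomialRandom_real_exists_dense_le`).

The chromatic number enters only through `μ ≥ 1`. -/

namespace RandomTuran

/-! ### Edge sets, clusters of cliques, and the potential `v - y e` -/

section EdgeSets

variable {α : Type*} [DecidableEq α]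

/-- The set of endpoints of a finite set of edges. -/
def endpoints (A : Finset (Sym2 α)) : Finset α := A.biUnion Sym2.toFinset

/-- The edges of the complete graph on `S`. -/
def completeEdges (S : Finset α) : Finset (Sym2 α) := S.sym2.filter fun e => ¬ e.IsDiag

theorem mem_endpoints {A : Finset (Sym2 α)} {v : α} : v ∈ endpoints A ↔ ∃ e ∈ A, v ∈ e := by
  simp [endpoints]

theorem mem_completeEdges {S : Finset α} {e : Sym2 α} :
    e ∈ completeEdges S ↔ (∀ v ∈ e, v ∈ S) ∧ ¬ e.IsDiag := by
  simp [completeEdges, Finset.mem_sym2_iff]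

theorem mk_mem_completeEdges {S : Finset α} {a b : α} :
    s(a, b) ∈ completeEdges S ↔ a ∈ S ∧ b ∈ S ∧ a ≠ b := by
  simp [mem_completeEdges, and_assoc]

theorem card_completeEdges (S : Finset α) : (completeEdges S).card = S.card.choose 2 := by
  rw [← Sym2.card_image_offDiag]
  congr 1
  ext e
  induction e with | _ a b
  simp only [mk_mem_completeEdges, Finset.mem_image, Finset.mem_offDiag, Prod.exists]
  constructor
  · rintro ⟨ha, hb, hab⟩
    exact ⟨a, b, ⟨ha, hb, hab⟩, rfl⟩
  · rintro ⟨x, y, ⟨hx, hy, hxy⟩, h⟩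
    rcases Sym2.eq_iff.1 h with ⟨rfl, rfl⟩ | ⟨rfl, rfl⟩
    · exact ⟨hx, hy, hxy⟩
    · exact ⟨hy, hx, hxy.symm⟩

theorem endpoints_mono {A B : Finset (Sym2 α)} (h : A ⊆ B) : endpoints A ⊆ endpoints B :=
  Finset.biUnion_subset_biUnion_of_subset_left _ h

theorem endpoints_union (A B : Finset (Sym2 α)) :
    endpoints (A ∪ B) = endpoints A ∪ endpoints B := Finset.union_biUnion

theorem endpoints_completeEdges_subset (S : Finset α) : endpoints (completeEdges S) ⊆ S := by
  intro v hv
  obtain ⟨e, he, hve⟩ := mem_endpoints.1 hv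
  exact (mem_completeEdges.1 he).1 v hve

theorem endpoints_completeEdges {S : Finset α} (hS : 2 ≤ S.card) :
    endpoints (completeEdges S) = S := by
  refine (endpoints_completeEdges_subset S).antisymm fun v hv => ?_
  obtain ⟨w, hw, hwv⟩ := Finset.exists_mem_ne (by omega : 1 < S.card) v
  exact mem_endpoints.2 ⟨s(v, w), mk_mem_completeEdges.2 ⟨hv, hw, hwv.symm⟩, by simp⟩

theorem subset_completeEdges_endpoints {A : Finset (Sym2 α)} (hA : ∀ e ∈ A, ¬ e.IsDiag) :
    A ⊆ completeEdges (endpoints A) := fun e he =>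
  mem_completeEdges.2 ⟨fun _ hv => mem_endpoints.2 ⟨e, he, hv⟩, hA e he⟩

theorem two_le_card_endpoints {A : Finset (Sym2 α)} {e : Sym2 α} (he : e ∈ A) (hd : ¬ e.IsDiag) :
    2 ≤ (endpoints A).card := by
  rw [← Sym2.card_toFinset_of_not_isDiag e hd]
  exact Finset.card_le_card (Finset.subset_biUnion_of_mem Sym2.toFinset he)

/-- Gluing a clique on `m` vertices along an edge keeps `2 (e - 1) ≥ (m + 1) (v - 2)`. -/
theorem dense_union_completeEdges {m : ℕ} {U : Finset (Sym2 α)} {K : Finset α}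
    (hK : K.card = m) {e : Sym2 α} (he : e ∈ completeEdges K) (heU : e ∈ U)
    (hU : ((m : ℝ) + 1) / 2 * ((endpoints U).card - 2) + 1 ≤ U.card) :
    ((m : ℝ) + 1) / 2 * ((endpoints (U ∪ completeEdges K)).card - 2) + 1 ≤
      (U ∪ completeEdges K).card := by
  obtain ⟨heK, hd⟩ := mem_completeEdges.1 he
  have hm : 2 ≤ K.card := (two_le_card_endpoints he hd).trans
    (Finset.card_le_card (endpoints_completeEdges_subset K))
  rw [endpoints_union, endpoints_completeEdges hm]
  have hk : 2 ≤ (endpoints U ∩ K).card := by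
    rw [← Sym2.card_toFinset_of_not_isDiag e hd]
    refine Finset.card_le_card fun v hv => ?_
    rw [Sym2.mem_toFinset] at hv
    exact Finset.mem_inter.2 ⟨mem_endpoints.2 ⟨e, heU, hv⟩, heK v hv⟩
  have hkm : (endpoints U ∩ K).card ≤ m := hK ▸ Finset.card_le_card Finset.inter_subset_right
  have hsub : U ∩ completeEdges K ⊆ completeEdges (endpoints U ∩ K) := by
    intro f hf
    obtain ⟨hfU, hfK⟩ := Finset.mem_inter.1 hf
    obtain ⟨h1, h2⟩ := mem_completeEdges.1 hfK
    exact mem_completeEdges.2 ⟨fun v hv =>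
      Finset.mem_inter.2 ⟨mem_endpoints.2 ⟨f, hfU, hv⟩, h1 v hv⟩, h2⟩
  have hinter := Finset.card_le_card hsub
  rw [card_completeEdges] at hinter
  have hV := Finset.card_union_add_card_inter (endpoints U) K
  have hE := Finset.card_union_add_card_inter U (completeEdges K)
  rw [card_completeEdges, hK] at hE
  rw [hK] at hV
  have h1 : (((endpoints U ∪ K).card : ℕ) : ℝ) =
      (endpoints U).card + m - (endpoints U ∩ K).card := by
    rw [eq_sub_iff_add_eq]; exact_mod_cast hV
  have h2 : (((U ∪ completeEdges K).card : ℕ) : ℝ) =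
      U.card + m * (m - 1) / 2 - (U ∩ completeEdges K).card := by
    rw [eq_sub_iff_add_eq, ← Nat.cast_choose_two]; exact_mod_cast hE
  have h3 : ((U ∩ completeEdges K).card : ℝ) ≤
      (endpoints U ∩ K).card * ((endpoints U ∩ K).card - 1) / 2 := by
    rw [← Nat.cast_choose_two]; exact_mod_cast hinter
  rw [h1, h2]
  have h4 : (2 : ℝ) ≤ (endpoints U ∩ K).card := by exact_mod_cast hk
  have h5 : ((endpoints U ∩ K).card : ℝ) ≤ m := by exact_mod_cast hkm
  -- If `K` meets the old vertices in `i ≥ 2` points, it brings `m - i` new vertices and at least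
  -- `(m - i)(m + i - 1)/2` new edges; the surplus over `(m + 1)/2` edges per vertex is `(m - i)(i -
  -- 2)/2`.
  nlinarith [mul_nonneg (sub_nonneg.2 h4) (sub_nonneg.2 h5)]

/-- The cluster of a clique `K` in a family `𝒦` of cliques. -/
theorem exists_cluster {m : ℕ} (hm : 3 ≤ m) (𝒦 : Finset (Finset α))
    (h𝒦 : ∀ K ∈ 𝒦, K.card = m) {K : Finset α} (hK : K ∈ 𝒦) :
    ∃ 𝒞 ⊆ 𝒦, K ∈ 𝒞 ∧
      ((m : ℝ) + 1) / 2 * ((endpoints (𝒞.biUnion completeEdges)).card - 2) + 1 ≤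
        (𝒞.biUnion completeEdges).card ∧
      ∀ L ∈ 𝒦 \ 𝒞, Disjoint (completeEdges L) (𝒞.biUnion completeEdges) := by
  classical
  let P : Finset (Finset α) → Prop := fun 𝒞 => K ∈ 𝒞 ∧
      ((m : ℝ) + 1) / 2 * ((endpoints (𝒞.biUnion completeEdges)).card - 2) + 1 ≤
        (𝒞.biUnion completeEdges).card
  have hne : (𝒦.powerset.filter P).Nonempty := by
    refine ⟨{K}, Finset.mem_filter.2 ⟨by simpa using hK, by simp, ?_⟩⟩
    have hKm := h𝒦 K hK
    rw [Finset.singleton_biUnion, endpoints_completeEdges (by omega), card_completeEdges, hKm,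
      Nat.cast_choose_two]
    apply le_of_eq
    ring
  -- A cluster is a largest dense subfamily containing `K`; a further clique sharing an edge with it
  -- could be glued on, contradicting maximality.
  obtain ⟨𝒞, hmem, hmax⟩ := Finset.exists_max_image _ Finset.card hne
  obtain ⟨hsub, hKC, hdense⟩ := Finset.mem_filter.1 hmem
  rw [Finset.mem_powerset] at hsub
  refine ⟨𝒞, hsub, hKC, hdense, fun L hL => ?_⟩
  obtain ⟨hL𝒦, hL𝒞⟩ := Finset.mem_sdiff.1 hL
  by_contra hdis
  obtain ⟨e, heL, heU⟩ := Finset.not_disjoint_iff.1 hdis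
  have hbig : insert L 𝒞 ∈ 𝒦.powerset.filter P := by
    refine Finset.mem_filter.2 ⟨Finset.mem_powerset.2 (Finset.insert_subset hL𝒦 hsub),
      Finset.mem_insert_of_mem hKC, ?_⟩
    rw [Finset.biUnion_insert, Finset.union_comm]
    exact dense_union_completeEdges (h𝒦 L hL𝒦) heL heU hdense
  have := hmax _ hbig
  rw [Finset.card_insert_of_notMem hL𝒞] at this
  omega

/-- Covering a sparse edge set by cliques lowers `v - y e` in proportion to the number of covered
edges. -/
theorem card_endpoints_union_cliques_le {m : ℕ} (hm : 3 ≤ m) {μ δ γ ε y : ℝ} (hμ : 1 ≤ μ)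
    (hy : 0 ≤ y) (hyμ : y = 1 / μ - δ) (hδ : 0 ≤ δ) (hε : 0 ≤ ε) (hδγ : δ ≤ γ)
    (hγ : 2 * γ ≤ y * (((m : ℝ) + 1) / 2) - 1) (hεγ : ε * (μ + 1) ≤ γ)
    (E : Finset (Sym2 α))
    (hE : ∀ A ⊆ E, A.Nonempty → (A.card : ℝ) ≤ μ * ((endpoints A).card - 2) + 1)
    (𝒦 : Finset (Finset α)) (h𝒦 : ∀ K ∈ 𝒦, K.card = m)
    (h𝒦E : ∀ K ∈ 𝒦, (E ∩ completeEdges K).Nonempty) :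
    ((endpoints (E ∪ 𝒦.biUnion completeEdges)).card : ℝ) -
        y * (E ∪ 𝒦.biUnion completeEdges).card ≤
      (endpoints E).card - y * E.card - ε * (E ∩ 𝒦.biUnion completeEdges).card := by
  -- Remove a whole cluster at a time. Its edge set `U` is disjoint from that of the remaining
  -- cliques, so restoring it overlaps the old edges only inside `E`, where sparsity applies, and
  -- the covered edges of `E` add up.
  induction 𝒦 using Finset.strongInduction with
  | H 𝒦 ih =>
  obtain rfl | ⟨K, hK⟩ := 𝒦.eq_empty_or_nonempty
  · simp
  obtain ⟨𝒞, hsub, hKC, hdense, hdisj⟩ := exists_cluster hm 𝒦 h𝒦 hK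
  have IH := ih (𝒦 \ 𝒞) (Finset.sdiff_ssubset hsub ⟨K, hKC⟩)
    (fun L hL => h𝒦 L (Finset.mem_sdiff.1 hL).1) (fun L hL => h𝒦E L (Finset.mem_sdiff.1 hL).1)
  set U := 𝒞.biUnion completeEdges with hUdef
  set Y := (𝒦 \ 𝒞).biUnion completeEdges with hYdef
  have hYU : Disjoint Y U := by
    rw [hYdef, Finset.disjoint_biUnion_left]
    exact hdisj
  have hsplit : 𝒦.biUnion completeEdges = Y ∪ U := by
    rw [hYdef, hUdef, ← Finset.union_biUnion, Finset.sdiff_union_of_subset hsub]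
  have hXU : (E ∪ Y) ∩ U = E ∩ U := by
    rw [Finset.union_inter_distrib_right, Finset.disjoint_iff_inter_eq_empty.1 hYU,
      Finset.union_empty]
  have hAne : (E ∩ U).Nonempty := (h𝒦E K hK).mono
    (Finset.inter_subset_inter_left (Finset.subset_biUnion_of_mem completeEdges hKC))
  have hA := hE _ Finset.inter_subset_left hAne
  have hKU : K ⊆ endpoints U := by
    rw [← endpoints_completeEdges (S := K) (by rw [h𝒦 K hK]; omega)]
    exact endpoints_mono (Finset.subset_biUnion_of_mem completeEdges hKC)
  have hu3 : (3 : ℝ) ≤ (endpoints U).card := by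
    exact_mod_cast (h𝒦 K hK ▸ hm).trans (Finset.card_le_card hKU)
  have hau : ((endpoints (E ∩ U)).card : ℝ) ≤ (endpoints U).card := by
    exact_mod_cast Finset.card_le_card (endpoints_mono Finset.inter_subset_right)
  have hverts : ((endpoints (E ∪ (Y ∪ U))).card : ℝ) + (endpoints (E ∩ U)).card ≤
      (endpoints (E ∪ Y)).card + (endpoints U).card := by
    have h1 := Finset.card_union_add_card_inter (endpoints (E ∪ Y)) (endpoints U)
    have h2 : endpoints (E ∩ U) ⊆ endpoints (E ∪ Y) ∩ endpoints U :=
      Finset.subset_inter (endpoints_mono (Finset.inter_subset_left.trans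
        Finset.subset_union_left)) (endpoints_mono Finset.inter_subset_right)
    have h3 := Finset.card_le_card h2
    rw [← endpoints_union, Finset.union_assoc] at h1
    exact_mod_cast (by omega : (endpoints (E ∪ (Y ∪ U))).card + (endpoints (E ∩ U)).card ≤
      (endpoints (E ∪ Y)).card + (endpoints U).card)
  have hedges : ((E ∪ (Y ∪ U)).card : ℝ) + (E ∩ U).card = (E ∪ Y).card + U.card := by
    have h1 := Finset.card_union_add_card_inter (E ∪ Y) U
    rw [hXU, Finset.union_assoc] at h1
    exact_mod_cast h1
  have hcov : ((E ∩ (Y ∪ U)).card : ℝ) = (E ∩ Y).card + (E ∩ U).card := by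
    rw [Finset.inter_union_distrib_left, Finset.card_union_of_disjoint]
    · push_cast; rfl
    · exact hYU.mono Finset.inter_subset_right Finset.inter_subset_right
  rw [hsplit]
  have hμ0 : 0 < μ := by linarith
  set u : ℝ := ((endpoints U).card : ℝ)
  set a : ℝ := ((endpoints (E ∩ U)).card : ℝ)
  set k : ℝ := ((E ∩ U).card : ℝ)
  have hk0 : 0 ≤ k := Nat.cast_nonneg _
  -- Restoring the cluster changes `v - y e` by at most `(u - y |U|) - (a - y k)`. The next two
  -- bounds make this at most `δ - 2γ(u - 2)`; one `γ(u - 2)` absorbs `δ`, the other pays for `ε k`.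
  have step1 : u - y * U.card ≤ 2 - y - 2 * γ * (u - 2) := by
    have := mul_le_mul_of_nonneg_left hdense hy
    nlinarith
  have step2 : 2 - 1 / μ ≤ a - y * k := by
    have h1 : k / μ ≤ a - 2 + 1 / μ := by
      rw [div_le_iff₀ hμ0]
      have : (a - 2 + 1 / μ) * μ = μ * (a - 2) + 1 := by field_simp
      linarith
    have h2 : y * k = k / μ - δ * k := by rw [hyμ]; ring
    nlinarith [mul_nonneg hδ hk0]
  have step3 : ε * k ≤ γ * (u - 2) := by
    have h1 : k ≤ (μ + 1) * (u - 2) := by nlinarith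
    calc ε * k ≤ ε * ((μ + 1) * (u - 2)) := by gcongr
      _ = ε * (μ + 1) * (u - 2) := by ring
      _ ≤ _ := by gcongr; linarith
  have step4 : δ ≤ γ * (u - 2) := by nlinarith
  rw [hcov]
  have hyE : y * (E ∪ (Y ∪ U)).card = y * (E ∪ Y).card + y * U.card - y * k := by
    rw [eq_sub_iff_add_eq, ← mul_add, ← mul_add, hedges]
  linarith

end EdgeSets

end RandomTuran

namespace RandomTuran

/-! ### Bounds on the 2-density -/

section Density

/-- A subgraph on `v` vertices has at most `v.choose 2` edges, and `(v.choose 2 - 1)/(v - 2) = (v +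
1)/2` increases with `v`. -/
theorem twoDensity_top_le {m : ℕ} (hm : 3 ≤ m) :
    twoDensity (⊤ : SimpleGraph (Fin m)) ≤ ((m : ℝ) + 1) / 2 := by
  classical
  obtain ⟨H, hH, hx⟩ := (isGreatest_twoDensity (⊤ : SimpleGraph (Fin m)) (by simpa using hm)).1
  rw [hx]
  have hv : H.verts.ncard ≤ m := by
    simpa [Set.ncard_univ] using Set.ncard_le_ncard (Set.subset_univ H.verts)
  have he : H.edgeSet.ncard ≤ H.verts.ncard.choose 2 := by
    rw [Set.ncard_eq_toFinset_card' H.verts, ← card_completeEdges, ← Set.ncard_coe_finset]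
    refine Set.ncard_le_ncard fun e he => ?_
    rw [Finset.mem_coe, mem_completeEdges]
    refine ⟨fun v hv => ?_, SimpleGraph.not_isDiag_of_mem_edgeSet _ (H.edgeSet_subset he)⟩
    simpa using H.mem_verts_of_mem_edge he hv
  have he' : (H.edgeSet.ncard : ℝ) ≤ H.verts.ncard * (H.verts.ncard - 1) / 2 := by
    rw [← Nat.cast_choose_two]; exact_mod_cast he
  have h3 : (3 : ℝ) ≤ H.verts.ncard := by exact_mod_cast hH
  have hvm : (H.verts.ncard : ℝ) ≤ m := by exact_mod_cast hv
  rw [div_le_iff₀ (by linarith)]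
  nlinarith

/-- The edges form a matching; after ordering the vertices, the larger end of each edge gets colour
`0` and every other vertex colour `1`. -/
theorem colorable_two_of_degree_le_one {V : Type*} [Finite V] {H : SimpleGraph V}
    (h : ∀ a b c, H.Adj a b → H.Adj a c → b = c) : H.Colorable 2 := by
  classical
  have := Fintype.ofFinite V
  have : LinearOrder V := LinearOrder.lift' (Fintype.equivFin V) (Fintype.equivFin V).injective
  refine ⟨SimpleGraph.Coloring.mk (fun v => if ∃ w, H.Adj v w ∧ w < v then 0 else 1) ?_⟩
  have key : ∀ a b, H.Adj a b → a < b → (if ∃ w, H.Adj a w ∧ w < a then (0 : Fin 2) else 1) ≠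
      if ∃ w, H.Adj b w ∧ w < b then 0 else 1 := by
    intro a b hab hlt
    rw [if_neg, if_pos ⟨a, hab.symm, hlt⟩]
    · decide
    · rintro ⟨w, haw, hwa⟩
      rw [h a b w hab haw] at hlt
      exact lt_asymm hlt hwa
  intro a b hab
  rcases lt_or_gt_of_ne hab.ne with hlt | hlt
  · exact key a b hab hlt
  · exact (key b a hab.symm hlt).symm

variable {V : Type*} [Fintype V] [DecidableEq V] {H : SimpleGraph V}

/-- The maximum defining `m₂` covers three or more endpoints; with two endpoints `A` is a single
edge and the bound reads `1 ≤ 1`. -/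
theorem card_le_twoDensity {A : Finset (Sym2 V)} (hA : ↑A ⊆ H.edgeSet)
    (hne : A.Nonempty) :
    (A.card : ℝ) ≤ twoDensity H * ((endpoints A).card - 2) + 1 := by
  have hd : ∀ e ∈ A, ¬ e.IsDiag := fun e he => SimpleGraph.not_isDiag_of_mem_edgeSet _ (hA he)
  obtain ⟨e, he⟩ := hne
  rcases (two_le_card_endpoints he (hd e he)).eq_or_lt with h2 | h3
  · have := Finset.card_le_card (subset_completeEdges_endpoints hd)
    rw [card_completeEdges, ← h2] at this
    rw [← h2]
    have : (A.card : ℝ) ≤ 1 := by exact_mod_cast this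
    simpa using this
  · let H' : H.Subgraph :=
      { verts := endpoints A
        Adj := fun a b => s(a, b) ∈ A
        adj_sub := fun h => hA h
        edge_vert := fun h => mem_endpoints.2 ⟨_, h, by simp⟩
        symm := ⟨fun a b h => by rwa [Sym2.eq_swap]⟩ }
    have hv : H'.verts.ncard = (endpoints A).card := Set.ncard_coe_finset _
    have hE : H'.edgeSet = (A : Set (Sym2 V)) := by
      ext e
      induction e with | _ a b
      rfl
    have h3V : 3 ≤ Fintype.card V := le_trans h3 (Finset.card_le_univ _)
    have := (isGreatest_twoDensity H h3V).2 ⟨H', by rw [hv]; exact h3, rfl⟩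
    rw [hE, hv, Set.ncard_coe_finset] at this
    have h3' : (3 : ℝ) ≤ (endpoints A).card := by exact_mod_cast h3
    rw [div_le_iff₀ (by linarith)] at this
    linarith

/-- Some vertex has two neighbours, and a path with two edges has ratio `(2 - 1)/(3 - 2) = 1`. -/
theorem one_le_twoDensity (hH : ¬ H.Colorable 2) : 1 ≤ twoDensity H := by
  obtain ⟨a, b, c, hab, hac, hbc⟩ : ∃ a b c, H.Adj a b ∧ H.Adj a c ∧ b ≠ c := by
    by_contra! hcon
    exact hH (colorable_two_of_degree_le_one hcon)
  have h3 : ({a, b, c} : Finset V).card = 3 :=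
    Finset.card_eq_three.2 ⟨a, b, c, hab.ne, hac.ne, hbc, rfl⟩
  let H' : H.Subgraph := (⊤ : H.Subgraph).induce (({a, b, c} : Finset V) : Set V)
  have hv : H'.verts.ncard = 3 := by
    rw [← h3]; exact Set.ncard_coe_finset _
  have hE : 2 ≤ H'.edgeSet.ncard := by
    have hsub : (({s(a, b), s(a, c)} : Finset (Sym2 V)) : Set (Sym2 V)) ⊆ H'.edgeSet := by
      intro e he
      simp only [Finset.coe_insert, Finset.coe_singleton, Set.mem_insert_iff,
        Set.mem_singleton_iff] at he
      rcases he with rfl | rfl <;> simp [H', hab, hac]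
    have := Set.ncard_le_ncard hsub
    rwa [Set.ncard_coe_finset, Finset.card_pair] at this
    simpa [hac.ne] using hbc
  have := (isGreatest_twoDensity H (h3 ▸ Finset.card_le_univ _)).2 ⟨H', by rw [hv], rfl⟩
  refine le_trans ?_ this
  rw [hv]
  have : (2 : ℝ) ≤ H'.edgeSet.ncard := by exact_mod_cast hE
  norm_num
  linarith

end Density

/-! ### The union of the `m`-cliques, and the dense subgraph forced by a copy of `H` -/

section CliqueGraph

variable {α : Type*}

/-- The subgraph of `G` formed by the edges lying in cliques of size `m`. -/
def cliqueGraph (m : ℕ) (G : SimpleGraph α) : SimpleGraph α where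
  Adj a b := a ≠ b ∧ ∃ K, G.IsNClique m K ∧ a ∈ K ∧ b ∈ K
  symm := ⟨fun _ _ ⟨h, K, hK, ha, hb⟩ => ⟨h.symm, K, hK, hb, ha⟩⟩
  loopless := ⟨fun _ h => h.1 rfl⟩

theorem cliqueGraph_le (m : ℕ) (G : SimpleGraph α) : cliqueGraph m G ≤ G :=
  fun _ _ ⟨h, _, hK, ha, hb⟩ => hK.isClique ha hb h

theorem isNClique_cliqueGraph_iff {m : ℕ} {G : SimpleGraph α} {K : Finset α} :
    (cliqueGraph m G).IsNClique m K ↔ G.IsNClique m K :=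
  ⟨fun h => h.mono (cliqueGraph_le m G), fun h =>
    ⟨fun _ ha _ hb hab => ⟨hab, K, h, ha, hb⟩, h.card_eq⟩⟩

variable [DecidableEq α]

theorem coe_completeEdges_subset_iff {G : SimpleGraph α} {K : Finset α} :
    ↑(completeEdges K) ⊆ G.edgeSet ↔ G.IsClique K := by
  constructor
  · intro h a ha b hb hab
    exact h (mk_mem_completeEdges.2 ⟨ha, hb, hab⟩)
  · intro h e he
    induction e with | _ a b
    obtain ⟨ha, hb, hab⟩ := mk_mem_completeEdges.1 he
    exact h ha hb hab

theorem endpoints_image {β : Type*} [DecidableEq β] (f : β → α) (A : Finset (Sym2 β)) :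
    endpoints (A.image (Sym2.map f)) = (endpoints A).image f := by
  ext v
  simp only [mem_endpoints, Finset.mem_image]
  constructor
  · rintro ⟨_, ⟨e, he, rfl⟩, hv⟩
    obtain ⟨w, hw, rfl⟩ := Sym2.mem_map.1 hv
    exact ⟨w, ⟨e, he, hw⟩, rfl⟩
  · rintro ⟨w, ⟨e, he, hw⟩, rfl⟩
    exact ⟨_, ⟨e, he, rfl⟩, Sym2.mem_map.2 ⟨w, hw, rfl⟩⟩

/-- If a copy of `H` lies in the union of the `m`-cliques of `G`, then `G` has a dense subgraph on a
bounded number of vertices. -/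
theorem exists_dense_of_copy {V : Type*} [Fintype V] {H : SimpleGraph V} {m : ℕ} (hm : 3 ≤ m)
    {c δ γ ε y : ℝ} (hμ : 1 ≤ twoDensity H) (hμc : twoDensity H ≤ c)
    (hy : 0 ≤ y) (hyμ : y = 1 / twoDensity H - δ) (hδ : 0 ≤ δ) (hε : 0 < ε) (hδγ : δ ≤ γ)
    (hγ : 2 * γ ≤ y * (((m : ℝ) + 1) / 2) - 1) (hεγ : ε * (c + 1) ≤ γ) (hδε : δ ≤ ε / 2)
    (H₀ : H.Subgraph)
    (hH₀ : ((H₀.edgeSet.ncard : ℝ) - 1) / ((H₀.verts.ncard : ℝ) - 2) = twoDensity H)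
    (h₀3 : 3 ≤ H₀.verts.ncard) (h₀ : 6 / ε + 1 ≤ H₀.verts.ncard)
    {G : SimpleGraph α} (f : H.Copy (cliqueGraph m G)) :
    ∃ F : Finset (Sym2 α), ↑F ⊆ G.edgeSet ∧ (endpoints F).card ≤ Fintype.card (Sym2 V) * m ∧
      ((endpoints F).card : ℝ) + 1 ≤ y * F.card := by
  classical
  have hfinj : Function.Injective f := f.injective
  have hinj : Function.Injective (Sym2.map f) := Sym2.map.injective hfinj
  let E₀ : Finset (Sym2 V) := H₀.edgeSet.toFinset
  have hE₀card : E₀.card = H₀.edgeSet.ncard := (Set.ncard_eq_toFinset_card' _).symm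
  let E : Finset (Sym2 α) := E₀.image (Sym2.map f)
  have hEcard : E.card = H₀.edgeSet.ncard := by
    rw [← hE₀card]; exact Finset.card_image_of_injective _ hinj
  have hEclique : ∀ e ∈ E, ∃ K, G.IsNClique m K ∧ e ∈ completeEdges K := by
    intro e he
    obtain ⟨e', he', rfl⟩ := Finset.mem_image.1 he
    have h1 : e' ∈ H.edgeSet := H₀.edgeSet_subset (by simpa [E₀] using he')
    induction e' with | _ a b
    obtain ⟨hne, K, hK, ha, hb⟩ := f.toHom.map_adj h1
    exact ⟨K, hK, mk_mem_completeEdges.2 ⟨ha, hb, hne⟩⟩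
  choose! Kf hKf heKf using hEclique
  let 𝒦 : Finset (Finset α) := E.image Kf
  have h𝒦 : ∀ K ∈ 𝒦, G.IsNClique m K := by
    intro K hK
    obtain ⟨e, he, rfl⟩ := Finset.mem_image.1 hK
    exact hKf e he
  have hEsub : E ⊆ 𝒦.biUnion completeEdges := fun e he =>
    Finset.mem_biUnion.2 ⟨Kf e, Finset.mem_image_of_mem _ he, heKf e he⟩
  have hsparse : ∀ A ⊆ E, A.Nonempty →
      (A.card : ℝ) ≤ twoDensity H * ((endpoints A).card - 2) + 1 := by
    intro A hA hne
    obtain ⟨B, hB, rfl⟩ := Finset.subset_image_iff.1 hA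
    rw [endpoints_image, Finset.card_image_of_injective _ hinj,
      Finset.card_image_of_injective _ hfinj]
    refine card_le_twoDensity (fun e he => H₀.edgeSet_subset ?_)
      (Finset.image_nonempty.1 hne)
    simpa [E₀] using hB he
  have hmain := card_endpoints_union_cliques_le hm hμ hy hyμ hδ hε.le hδγ hγ
    ((mul_le_mul_of_nonneg_left (by linarith) hε.le).trans hεγ) E hsparse 𝒦
    (fun K hK => (h𝒦 K hK).card_eq) (fun K hK => by
      obtain ⟨e, he, rfl⟩ := Finset.mem_image.1 hK
      exact ⟨e, Finset.mem_inter.2 ⟨he, heKf e he⟩⟩)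
  rw [Finset.union_eq_right.2 hEsub, Finset.inter_eq_left.2 hEsub] at hmain
  refine ⟨𝒦.biUnion completeEdges, ?_, ?_, ?_⟩
  · intro e he
    obtain ⟨K, hK, heK⟩ := Finset.mem_biUnion.1 he
    exact coe_completeEdges_subset_iff.2 (h𝒦 K hK).isClique heK
  · have hsub : endpoints (𝒦.biUnion completeEdges) ⊆ 𝒦.biUnion id := by
      intro v hv
      obtain ⟨e, he, hve⟩ := mem_endpoints.1 hv
      obtain ⟨K, hK, heK⟩ := Finset.mem_biUnion.1 he
      exact Finset.mem_biUnion.2 ⟨K, hK, (mem_completeEdges.1 heK).1 v hve⟩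
    calc (endpoints (𝒦.biUnion completeEdges)).card ≤ (𝒦.biUnion id).card :=
          Finset.card_le_card hsub
      _ ≤ 𝒦.card * m := Finset.card_biUnion_le_card_mul _ _ _ fun K hK => (h𝒦 K hK).card_eq.le
      _ ≤ _ := Nat.mul_le_mul_right _ <| by
        calc 𝒦.card ≤ E.card := Finset.card_image_le
          _ ≤ E₀.card := Finset.card_image_le
          _ ≤ _ := Finset.card_le_univ _
  · have hEv : (endpoints E).card ≤ H₀.verts.ncard := by
      rw [endpoints_image, Finset.card_image_of_injective _ hfinj,
        Set.ncard_eq_toFinset_card']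
      refine Finset.card_le_card fun v hv => ?_
      obtain ⟨e, he, hve⟩ := mem_endpoints.1 hv
      simpa using H₀.mem_verts_of_mem_edge (by simpa [E₀] using he) hve
    have hEv' : ((endpoints E).card : ℝ) ≤ H₀.verts.ncard := by exact_mod_cast hEv
    have h₀3' : (3 : ℝ) ≤ H₀.verts.ncard := by exact_mod_cast h₀3
    rw [hEcard] at hmain
    rw [div_eq_iff (by linarith)] at hH₀
    set μ := twoDensity H
    set v : ℝ := (H₀.verts.ncard : ℝ)
    set e : ℝ := (H₀.edgeSet.ncard : ℝ)
    have hμ0 : 0 < μ := by linarith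
    -- So `H₀` has `v - y e = 2 - 1/μ + δ e`. The cliques subtract `ε e`; since `δ e ≤ ε e / 2` and
    -- `ε e ≥ 6`, the result is at most `2 - 3 = -1`.
    have hye : y * e = v - 2 + 1 / μ - δ * e := by
      have : e = μ * (v - 2) + 1 := by linarith
      rw [hyμ, sub_mul]
      congr 1
      rw [this]
      field_simp
    have hev : v - 1 ≤ e := by nlinarith
    have h6 : 6 ≤ ε * e := by
      have : 6 / ε ≤ e := by linarith
      rw [div_le_iff₀ hε] at this
      linarith
    have hδe : δ * e ≤ ε / 2 * e := mul_le_mul_of_nonneg_right hδε (Nat.cast_nonneg _)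
    have hμinv : 0 < 1 / μ := by positivity
    linarith

end CliqueGraph

end RandomTuran

namespace RandomTuran

/-! ### First moment bound for dense subgraphs -/

section Probability

open unitInterval SimpleGraph

theorem measurableSet_simpleGraph {V : Type*} [Finite V] (S : Set (SimpleGraph V)) :
    MeasurableSet S := by
  rw [← Set.preimage_image_eq S edgeSet_injective]
  exact measurable_edgeSet (Set.toFinite _).measurableSet

theorem binomialRandom_real_subset_edgeSet {V : Type*} [Finite V] (p : I)
    {A : Finset (Sym2 V)} (hA : ∀ e ∈ A, ¬ e.IsDiag) :
    (binomialRandom V p).real {G | ↑A ⊆ G.edgeSet} = (p : ℝ) ^ A.card := by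
  -- In the underlying product space the event is a cylinder fixing the coordinates in `A`.
  -- `fromEdgeSet` discards loops, hence the need for `hA`.
  have hset : (fun P : Sym2 V → Prop => {e | P e}) ⁻¹'
      (fromEdgeSet ⁻¹' {G : SimpleGraph V | ↑A ⊆ G.edgeSet}) =
      Set.pi (A : Set (Sym2 V)) fun _ => {True} := by
    ext P
    simp only [Set.mem_preimage, Set.mem_ofPred_eq, edgeSet_fromEdgeSet, Set.mem_pi,
      Set.mem_singleton_iff, eq_iff_iff, iff_true]
    constructor
    · intro h e he
      exact (h he).1
    · intro h e he
      exact ⟨h e he, hA e he⟩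
  rw [measureReal_def, binomialRandom_eq_map,
    Measure.map_apply measurable_fromEdgeSet (measurableSet_simpleGraph _),
    ProbabilityTheory.setBernoulli_apply', hset,
    Measure.infinitePi_pi _ (fun _ _ => MeasurableSet.of_discrete)]
  rw [Finset.prod_congr rfl (g := fun _ => (toNNReal p : ENNReal))]
  · simp
  · intro e he
    simp [hA e he, Set.indicator]

theorem rpow_neg_pow_le {n : ℕ} (hn : 1 ≤ n) {y q : ℝ} (hq : 0 ≤ q) (hqy : q ≤ (n : ℝ) ^ (-y))
    {k s : ℕ} (h : (s : ℝ) + 1 ≤ y * k) : q ^ k ≤ ((n : ℝ) ^ (s + 1))⁻¹ := by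
  have hn' : (1 : ℝ) ≤ n := by exact_mod_cast hn
  calc q ^ k ≤ ((n : ℝ) ^ (-y)) ^ k := pow_le_pow_left₀ hq hqy k
    _ = (n : ℝ) ^ (-(y * k)) := by
      rw [← Real.rpow_natCast, ← Real.rpow_mul (by positivity)]; ring_nf
    _ ≤ (n : ℝ) ^ (-((s + 1 : ℕ) : ℝ)) :=
      Real.rpow_le_rpow_of_exponent_le hn' (by push_cast; linarith)
    _ = _ := by rw [Real.rpow_neg (by positivity), Real.rpow_natCast]

/-- Union bound: for each `s ≤ C` there are at most `n ^ s` vertex sets, each spanned by at most `2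
^ (C.choose 2)` edge sets, each present with probability at most `n ^ (-(s + 1))`. The `+ 1` in the
density condition leaves a factor `1 / n`. -/
theorem binomialRandom_real_exists_dense_le {n : ℕ} (hn : 1 ≤ n) (p : I) {y : ℝ}
    (hp : (p : ℝ) ≤ (n : ℝ) ^ (-y)) (C : ℕ) :
    (binomialRandom (Fin n) p).real {G | ∃ F : Finset (Sym2 (Fin n)), ↑F ⊆ G.edgeSet ∧
        (endpoints F).card ≤ C ∧ ((endpoints F).card : ℝ) + 1 ≤ y * F.card} ≤
      (C + 1) * 2 ^ (C.choose 2) * (n : ℝ)⁻¹ := by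
  classical
  let bad : Finset (Finset (Sym2 (Fin n))) := Finset.univ.filter fun F =>
    (∀ e ∈ F, ¬ e.IsDiag) ∧ (endpoints F).card ≤ C ∧ ((endpoints F).card : ℝ) + 1 ≤ y * F.card
  have hn' : (1 : ℝ) ≤ n := by exact_mod_cast hn
  calc (binomialRandom (Fin n) p).real _
      ≤ (binomialRandom (Fin n) p).real (⋃ F ∈ bad, {G | ↑F ⊆ G.edgeSet}) := by
        refine measureReal_mono ?_ (measure_ne_top _ _)
        rintro G ⟨F, hF, h1, h2⟩
        refine Set.mem_biUnion (x := F) ?_ hF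
        exact Finset.mem_filter.2 ⟨Finset.mem_univ _,
          fun e he => not_isDiag_of_mem_edgeSet _ (hF he), h1, h2⟩
    _ ≤ ∑ F ∈ bad, (binomialRandom (Fin n) p).real {G | ↑F ⊆ G.edgeSet} :=
        measureReal_biUnion_finset_le _ _
    _ ≤ ∑ F ∈ bad, ((n : ℝ) ^ ((endpoints F).card + 1))⁻¹ := by
        refine Finset.sum_le_sum fun F hF => ?_
        obtain ⟨-, hd, -, h2⟩ := Finset.mem_filter.1 hF
        rw [binomialRandom_real_subset_edgeSet p hd]
        exact rpow_neg_pow_le hn p.2.1 hp h2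
    _ = ∑ s ∈ Finset.range (C + 1), ∑ S ∈ Finset.univ.powersetCard s,
          ∑ F ∈ bad with endpoints F = S, ((n : ℝ) ^ ((endpoints F).card + 1))⁻¹ := by
        rw [← Finset.sum_fiberwise_of_maps_to (s := bad) (t := Finset.range (C + 1))
          (g := fun F => (endpoints F).card)]
        · refine Finset.sum_congr rfl fun s _ => ?_
          rw [← Finset.sum_fiberwise_of_maps_to (t := Finset.univ.powersetCard s)
            (g := fun F => endpoints F)]
          · refine Finset.sum_congr rfl fun S hS => ?_
            rw [Finset.filter_filter]
            refine Finset.sum_congr (Finset.filter_congr fun F _ => ?_) fun _ _ => rfl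
            constructor
            · exact fun h => h.2
            · rintro rfl
              exact ⟨(Finset.mem_powersetCard.1 hS).2, rfl⟩
          · intro F hF
            exact Finset.mem_powersetCard.2 ⟨Finset.subset_univ _, (Finset.mem_filter.1 hF).2⟩
        · intro F hF
          obtain ⟨-, -, h1, -⟩ := Finset.mem_filter.1 hF
          exact Finset.mem_range.2 (by omega)
    _ ≤ ∑ s ∈ Finset.range (C + 1), 2 ^ (C.choose 2) * (n : ℝ)⁻¹ := by
        refine Finset.sum_le_sum fun s hs => ?_
        have hsC : s ≤ C := by have := Finset.mem_range.1 hs; omega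
        calc _ ≤ ∑ S ∈ (Finset.univ : Finset (Fin n)).powersetCard s,
              (2 : ℝ) ^ (C.choose 2) * ((n : ℝ) ^ (s + 1))⁻¹ := by
              refine Finset.sum_le_sum fun S hS => ?_
              have hSs := (Finset.mem_powersetCard.1 hS).2
              have hcard : (bad.filter fun F => endpoints F = S).card ≤ 2 ^ (C.choose 2) := by
                calc _ ≤ (completeEdges S).powerset.card := by
                      refine Finset.card_le_card fun F hF => ?_
                      obtain ⟨hFb, rfl⟩ := Finset.mem_filter.1 hF
                      exact Finset.mem_powerset.2
                        (subset_completeEdges_endpoints (Finset.mem_filter.1 hFb).2.1)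
                  _ = 2 ^ (s.choose 2) := by rw [Finset.card_powerset, card_completeEdges, hSs]
                  _ ≤ _ := Nat.pow_le_pow_right (by norm_num) (Nat.choose_le_choose 2 hsC)
              rw [Finset.sum_congr rfl (g := fun _ => ((n : ℝ) ^ (s + 1))⁻¹), Finset.sum_const,
                nsmul_eq_mul]
              · gcongr
                exact_mod_cast hcard
              · intro F hF
                rw [(Finset.mem_filter.1 hF).2, hSs]
          _ = 2 ^ (C.choose 2) * ((n.choose s : ℝ) * ((n : ℝ) ^ (s + 1))⁻¹) := by
              simp only [Finset.sum_const, Finset.card_powersetCard, Finset.card_univ,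
                Fintype.card_fin, nsmul_eq_mul]
              ring
          _ ≤ 2 ^ (C.choose 2) * ((n : ℝ) ^ s * ((n : ℝ) ^ (s + 1))⁻¹) := by
              gcongr
              exact_mod_cast Nat.choose_le_pow n s
          _ = _ := by
              rw [pow_succ, mul_inv, ← mul_assoc, ← mul_assoc, mul_assoc _ ((n : ℝ) ^ s),
                mul_inv_cancel₀ (by positivity), mul_one]
    _ = _ := by
        simp only [Finset.sum_const, Finset.card_range, nsmul_eq_mul]
        push_cast
        ring

end Probability

end RandomTuran

namespace RandomTuran

/-! ### Second moment method for the number of `m`-cliques -/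

section CliqueCount

open unitInterval SimpleGraph

open Classical in
/-- The vertex sets of the copies of `K_m` in `G`. -/
noncomputable def cliques {α : Type*} [Fintype α] [DecidableEq α] (m : ℕ) (G : SimpleGraph α) :
    Finset (Finset α) :=
  (Finset.univ.powersetCard m).filter fun S : Finset α => ↑(completeEdges S) ⊆ G.edgeSet

theorem mem_cliques {α : Type*} [Fintype α] [DecidableEq α] {m : ℕ} {G : SimpleGraph α}
    {S : Finset α} :
    S ∈ cliques m G ↔ G.IsNClique m S := by
  classical
  rw [cliques, Finset.mem_filter, Finset.mem_powersetCard, isNClique_iff,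
    coe_completeEdges_subset_iff]
  simp [and_comm]

/-- A copy of `K_m` is determined by its vertex set, being the subgraph of `G` induced on it. -/
theorem copyCount_top_eq_card_cliques {α : Type*} [Fintype α] [DecidableEq α] (m : ℕ)
    (G : SimpleGraph α) : G.copyCount (⊤ : SimpleGraph (Fin m)) = (cliques m G).card := by
  classical
  have hinj : Function.Injective fun K : Finset α => (⊤ : G.Subgraph).induce (K : Set α) := by
    intro K L h
    have := congrArg Subgraph.verts h
    simpa using this
  rw [copyCount, ← Finset.card_image_of_injective _ hinj]
  congr 1
  ext G'
  simp only [Finset.mem_filter, Finset.mem_univ, true_and, Finset.mem_image, mem_cliques]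
  constructor
  · rintro ⟨e⟩
    have hadj : ∀ a b, a ∈ G'.verts → b ∈ G'.verts → a ≠ b → G'.Adj a b := by
      intro a b ha hb hab
      have : (⊤ : SimpleGraph (Fin m)).Adj (e.symm ⟨a, ha⟩) (e.symm ⟨b, hb⟩) := by
        rw [top_adj]
        intro h
        exact hab (congrArg Subtype.val (e.symm.injective h))
      exact e.symm.map_adj_iff.1 this
    refine ⟨G'.verts.toFinset, ⟨?_, ?_⟩, ?_⟩
    · intro a ha b hb hab
      exact (hadj a b (by simpa using ha) (by simpa using hb) hab).adj_sub
    · rw [Set.toFinset_card, ← Fintype.card_congr e.toEquiv, Fintype.card_fin]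
    · ext a b
      · simp
      · simp only [Set.coe_toFinset, Subgraph.induce_adj, Subgraph.top_adj]
        exact ⟨fun ⟨ha, hb, h⟩ => hadj a b ha hb h.ne,
          fun h => ⟨G'.edge_vert h, G'.edge_vert h.symm, h.adj_sub⟩⟩
  · rintro ⟨K, hK, rfl⟩
    have e : Fin m ≃ K := (K.equivFinOfCardEq hK.card_eq).symm
    refine ⟨⟨e, ?_⟩⟩
    intro a b
    have hiff : ((⊤ : G.Subgraph).induce (K : Set α)).Adj (e a) (e b) ↔ a ≠ b := by
      simp only [Subgraph.induce_adj, Subgraph.top_adj]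
      constructor
      · rintro ⟨-, -, h⟩ rfl
        exact h.ne rfl
      · intro h
        exact ⟨(e a).2, (e b).2, hK.isClique (e a).2 (e b).2
          fun h' => h (e.injective (Subtype.ext h'))⟩
    rw [top_adj]
    exact hiff

theorem completeEdges_inter {α : Type*} [DecidableEq α] (S T : Finset α) :
    completeEdges S ∩ completeEdges T = completeEdges (S ∩ T) := by
  ext e
  simp only [Finset.mem_inter, mem_completeEdges]
  grind

theorem card_completeEdges_union {α : Type*} [DecidableEq α] {m : ℕ} {S T : Finset α}
    (hS : S.card = m) (hT : T.card = m) :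
    (completeEdges S ∪ completeEdges T).card + (S ∩ T).card.choose 2 =
      m.choose 2 + m.choose 2 := by
  rw [← card_completeEdges (S ∩ T), ← completeEdges_inter, Finset.card_union_add_card_inter,
    card_completeEdges, card_completeEdges, hS, hT]

/-- Choose `A = S ∩ T` inside `S`, then extend `A` to an `m`-set; dropping the requirement that the
extension avoid `S` only overcounts. -/
theorem card_filter_card_inter_le {α : Type*} [Fintype α] [DecidableEq α] {m k : ℕ}
    {S : Finset α} (hS : S.card = m) :
    ((Finset.univ.powersetCard m).filter fun T : Finset α => (S ∩ T).card = k).card ≤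
      m.choose k * (Fintype.card α - k).choose (m - k) := by
  calc _ ≤ ((S.powersetCard k).biUnion fun A =>
        (Finset.univ.powersetCard m).filter fun T => A ⊆ T).card := by
        refine Finset.card_le_card fun T hT => ?_
        obtain ⟨hT, hk⟩ := Finset.mem_filter.1 hT
        exact Finset.mem_biUnion.2 ⟨S ∩ T, Finset.mem_powersetCard.2
          ⟨Finset.inter_subset_left, hk⟩, Finset.mem_filter.2 ⟨hT, Finset.inter_subset_right⟩⟩
    _ ≤ (S.powersetCard k).card * (Fintype.card α - k).choose (m - k) := by
        refine Finset.card_biUnion_le_card_mul _ _ _ fun A hA => ?_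
        have hAk := (Finset.mem_powersetCard.1 hA).2
        rw [← hAk, ← Finset.card_compl, ← Finset.card_powersetCard]
        refine Finset.card_le_card_of_injOn (fun T => T \ A) ?_ ?_
        · intro T hT
          obtain ⟨hT, hAT⟩ := Finset.mem_filter.1 hT
          refine Finset.mem_powersetCard.2 ⟨fun v hv => ?_, ?_⟩
          · exact Finset.mem_compl.2 (Finset.mem_sdiff.1 hv).2
          · rw [Finset.card_sdiff_of_subset hAT, (Finset.mem_powersetCard.1 hT).2]
        · intro T hT T' hT' h
          have h1 := (Finset.mem_filter.1 hT).2
          have h2 := (Finset.mem_filter.1 hT').2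
          rw [← Finset.sdiff_union_of_subset h1, ← Finset.sdiff_union_of_subset h2]
          exact congrArg (· ∪ A) h
    _ = _ := by rw [Finset.card_powersetCard, hS]

theorem integrable_simpleGraph {V : Type*} [Finite V] (p : I) (f : SimpleGraph V → ℝ) :
    Integrable f (binomialRandom V p) := by
  have : MeasurableSingletonClass (SimpleGraph V) := ⟨fun _ => measurableSet_simpleGraph _⟩
  have : Finite (SimpleGraph V) := Finite.of_injective _ edgeSet_injective
  exact Integrable.of_finite

theorem not_isDiag_of_mem_completeEdges {α : Type*} [DecidableEq α] {S : Finset α} {e : Sym2 α}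
    (he : e ∈ completeEdges S) : ¬ e.IsDiag := (mem_completeEdges.1 he).2

theorem integral_indicator_subset_edgeSet {V : Type*} [Finite V] (p : I)
    {A : Finset (Sym2 V)} (hA : ∀ e ∈ A, ¬ e.IsDiag) :
    ∫ G, Set.indicator {G : SimpleGraph V | ↑A ⊆ G.edgeSet} (fun _ => (1 : ℝ)) G
      ∂(binomialRandom V p) = (p : ℝ) ^ A.card := by
  rw [← binomialRandom_real_subset_edgeSet p hA]
  exact integral_indicator_one (measurableSet_simpleGraph _)

variable {V : Type*} [Fintype V] [DecidableEq V]

theorem card_cliques_eq_sum (m : ℕ) (G : SimpleGraph V) :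
    ((cliques m G).card : ℝ) = ∑ S ∈ (Finset.univ : Finset V).powersetCard m,
      Set.indicator {G : SimpleGraph V | (completeEdges S : Set (Sym2 V)) ⊆ G.edgeSet} (fun _ => (1 : ℝ)) G := by
  classical
  rw [cliques, Finset.card_filter]
  push_cast
  refine Finset.sum_congr rfl fun S _ => ?_
  simp only [Set.indicator_apply]
  congr 1

theorem integral_card_cliques (p : I) (m : ℕ) :
    ∫ G, ((cliques m G).card : ℝ) ∂(binomialRandom V p) =
      (Fintype.card V).choose m * (p : ℝ) ^ m.choose 2 := by
  simp only [card_cliques_eq_sum]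
  rw [integral_finsetSum _ fun _ _ => integrable_simpleGraph _ _]
  rw [Finset.sum_congr rfl (g := fun _ => (p : ℝ) ^ m.choose 2)]
  · simp
  · intro S hS
    rw [integral_indicator_subset_edgeSet p fun e he => not_isDiag_of_mem_completeEdges he,
      card_completeEdges, (Finset.mem_powersetCard.1 hS).2]

theorem integral_card_cliques_sq (p : I) (m : ℕ) :
    ∫ G, ((cliques m G).card : ℝ) ^ 2 ∂(binomialRandom V p) =
      ∑ S ∈ (Finset.univ : Finset V).powersetCard m, ∑ T ∈ (Finset.univ : Finset V).powersetCard m,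
        (p : ℝ) ^ (completeEdges S ∪ completeEdges T : Finset (Sym2 V)).card := by
  simp only [card_cliques_eq_sum, sq, Finset.sum_mul_sum]
  rw [integral_finsetSum _ fun _ _ => integrable_simpleGraph _ _]
  refine Finset.sum_congr rfl fun S _ => ?_
  rw [integral_finsetSum _ fun _ _ => integrable_simpleGraph _ _]
  refine Finset.sum_congr rfl fun T _ => ?_
  rw [← integral_indicator_subset_edgeSet p]
  · congr 1
    ext G
    rw [← Set.inter_indicator_mul]
    simp only [mul_one, Finset.coe_union, Set.union_subset_iff]
    rfl
  · intro e he
    rcases Finset.mem_union.1 he with h | h <;> exact not_isDiag_of_mem_completeEdges h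

/-- Sort `T` by `k = |S ∩ T|`: the two cliques share `k.choose 2` edges. For `k ≤ 1` they share
none, and the first term bounds these by counting all `T`. -/
theorem sum_pow_card_union_le (p : I) (hp : 0 < (p : ℝ)) {m : ℕ} {S : Finset V}
    (hS : S.card = m) :
    ∑ T ∈ Finset.univ.powersetCard m,
        (p : ℝ) ^ (completeEdges S ∪ completeEdges T : Finset (Sym2 V)).card ≤
      (Fintype.card V).choose m * ((p : ℝ) ^ m.choose 2 * (p : ℝ) ^ m.choose 2) +
      ∑ k ∈ Finset.Icc 2 m, (m.choose k : ℝ) * ((Fintype.card V - k).choose (m - k) : ℝ) *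
        ((p : ℝ) ^ m.choose 2 * (p : ℝ) ^ m.choose 2 / (p : ℝ) ^ k.choose 2) := by
  have hterm : ∀ T ∈ (Finset.univ : Finset V).powersetCard m,
      (p : ℝ) ^ (completeEdges S ∪ completeEdges T : Finset (Sym2 V)).card =
        (p : ℝ) ^ m.choose 2 * (p : ℝ) ^ m.choose 2 / (p : ℝ) ^ (S ∩ T).card.choose 2 := by
    intro T hT
    rw [eq_div_iff (by positivity), ← pow_add, ← pow_add,
      card_completeEdges_union hS (Finset.mem_powersetCard.1 hT).2]
  rw [Finset.sum_congr rfl hterm,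
    ← Finset.sum_filter_add_sum_filter_not _ fun T => (S ∩ T).card ≤ 1]
  set q : ℝ := (p : ℝ) ^ m.choose 2 * (p : ℝ) ^ m.choose 2
  gcongr ?_ + ?_
  · rw [Finset.sum_congr rfl (g := fun _ => q)]
    · rw [Finset.sum_const, nsmul_eq_mul]
      gcongr
      refine (Finset.card_filter_le _ _).trans ?_
      rw [Finset.card_powersetCard, Finset.card_univ]
    · intro T hT
      rw [Nat.choose_eq_zero_of_lt (Nat.lt_succ_of_le (Finset.mem_filter.1 hT).2), pow_zero, div_one]
  · rw [← Finset.sum_fiberwise_of_maps_to (t := Finset.Icc 2 m) (g := fun T => (S ∩ T).card)]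
    · refine Finset.sum_le_sum fun k _ => ?_
      rw [Finset.sum_congr rfl (g := fun _ => q / (p : ℝ) ^ k.choose 2), Finset.sum_const,
        nsmul_eq_mul]
      · gcongr
        refine le_trans (Nat.cast_le.2 (Finset.card_le_card ?_))
          (by exact_mod_cast card_filter_card_inter_le (k := k) hS)
        exact Finset.filter_subset_filter _ (Finset.filter_subset _ _)
      · intro T hT
        rw [(Finset.mem_filter.1 hT).2]
    · intro T hT
      have h1 := (Finset.mem_filter.1 hT).2
      have h2 := Finset.card_le_card (Finset.inter_subset_left : S ∩ T ⊆ S)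
      exact Finset.mem_Icc.2 ⟨by omega, by omega⟩

theorem variance_card_cliques_le (p : I) (hp : 0 < (p : ℝ)) {m : ℕ} (hm : m ≤ Fintype.card V) :
    ProbabilityTheory.variance (fun G => ((cliques m G).card : ℝ)) (binomialRandom V p) ≤
      ((Fintype.card V).choose m * (p : ℝ) ^ m.choose 2) ^ 2 *
        ∑ k ∈ Finset.Icc 2 m, (m.choose k : ℝ) ^ 2 *
          ((Fintype.card V).choose k * (p : ℝ) ^ k.choose 2)⁻¹ := by
  rw [ProbabilityTheory.variance_eq_sub]
  · simp only [Pi.pow_apply]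
    rw [integral_card_cliques, integral_card_cliques_sq]
    have hsum := Finset.sum_le_sum fun S (hS : S ∈ (Finset.univ : Finset V).powersetCard m) =>
      sum_pow_card_union_le p hp (Finset.mem_powersetCard.1 hS).2
    refine (sub_le_sub_right hsum _).trans (le_of_eq ?_)
    -- The contribution bounding `k ≤ 1` cancels exactly against the squared mean.
    rw [Finset.sum_const, nsmul_eq_mul, Finset.card_powersetCard, Finset.card_univ, mul_add,
      Finset.mul_sum, Finset.mul_sum, add_comm, add_sub_assoc,
      sub_eq_zero.2 (by ring), add_zero]
    refine Finset.sum_congr rfl fun k hk => ?_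
    obtain ⟨-, hkm⟩ := Finset.mem_Icc.1 hk
    have hchoose : ((Fintype.card V).choose m : ℝ) * m.choose k =
        (Fintype.card V).choose k * (Fintype.card V - k).choose (m - k) := by
      exact_mod_cast Nat.choose_mul hkm
    have hpos : (0 : ℝ) < (Fintype.card V).choose k := by
      exact_mod_cast Nat.choose_pos (hkm.trans hm)
    field_simp
    linear_combination (-(m.choose k : ℝ) * (Fintype.card V).choose m) * hchoose
  · have : MeasurableSingletonClass (SimpleGraph V) := ⟨fun _ => measurableSet_simpleGraph _⟩
    have : Finite (SimpleGraph V) := Finite.of_injective _ edgeSet_injective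
    exact MemLp.of_discrete

/-- The variance bound needs the expected number of `k`-cliques to diverge for each `2 ≤ k ≤ m`.
This follows from the case `m`: as `m * k.choose 2 ≤ k * m.choose 2` and `p ≤ 1`, the `m`-th power
of `n ^ k * p ^ k.choose 2` dominates the `k`-th power of `n ^ m * p ^ m.choose 2`. -/
theorem tendsto_choose_mul_pow {p : ℕ → I} {m k : ℕ} (hk : 1 ≤ k) (hkm : k ≤ m)
    (h : Tendsto (fun n : ℕ => (n.choose m : ℝ) * (p n : ℝ) ^ m.choose 2) atTop atTop) :
    Tendsto (fun n : ℕ => (n.choose k : ℝ) * (p n : ℝ) ^ k.choose 2) atTop atTop := by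
  have hQ : Tendsto (fun n : ℕ => (n : ℝ) ^ k * (p n : ℝ) ^ k.choose 2) atTop atTop := by
    refine tendsto_atTop.2 fun B => ?_
    filter_upwards [h.eventually_ge_atTop (max 1 (|B| ^ m))] with n hn
    have hp0 : 0 ≤ (p n : ℝ) := (p n).2.1
    have hL : (n.choose m : ℝ) * (p n : ℝ) ^ m.choose 2 ≤ (n : ℝ) ^ m * (p n : ℝ) ^ m.choose 2 := by
      gcongr
      exact_mod_cast Nat.choose_le_pow n m
    have hexp : k.choose 2 * m ≤ m.choose 2 * k := by
      have : ((k.choose 2 * m : ℕ) : ℝ) ≤ ((m.choose 2 * k : ℕ) : ℝ) := by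
        push_cast
        rw [Nat.cast_choose_two, Nat.cast_choose_two]
        have h1 : (k : ℝ) ≤ m := by exact_mod_cast hkm
        nlinarith [mul_nonneg (mul_nonneg (Nat.cast_nonneg (α := ℝ) k) (Nat.cast_nonneg (α := ℝ) m))
          (sub_nonneg.2 h1)]
      exact_mod_cast this
    have hpow : |B| ^ m ≤ ((n : ℝ) ^ k * (p n : ℝ) ^ k.choose 2) ^ m := by
      have h1 : 1 ≤ (n : ℝ) ^ m * (p n : ℝ) ^ m.choose 2 := (le_max_left _ _).trans (hn.trans hL)
      calc |B| ^ m ≤ (n : ℝ) ^ m * (p n : ℝ) ^ m.choose 2 := (le_max_right _ _).trans (hn.trans hL)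
        _ ≤ ((n : ℝ) ^ m * (p n : ℝ) ^ m.choose 2) ^ k := le_self_pow₀ h1 (by omega)
        _ = (n : ℝ) ^ (k * m) * (p n : ℝ) ^ (m.choose 2 * k) := by
          rw [mul_pow, ← pow_mul, ← pow_mul, mul_comm m k]
        _ ≤ (n : ℝ) ^ (k * m) * (p n : ℝ) ^ (k.choose 2 * m) := by
          gcongr ?_ * ?_
          exact pow_le_pow_of_le_one hp0 (p n).2.2 hexp
        _ = _ := by rw [mul_pow, ← pow_mul, ← pow_mul]
    exact (le_abs_self B).trans (le_of_pow_le_pow_left₀ (by omega) (by positivity) hpow)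
  -- For `n ≥ 2k`, `n.choose k ≥ (n / 2) ^ k / k!`.
  have hc : (0 : ℝ) < ((2 : ℝ) ^ k * k.factorial)⁻¹ := by positivity
  refine tendsto_atTop_mono' _ ?_ (hQ.const_mul_atTop hc)
  filter_upwards [eventually_ge_atTop (2 * k)] with n hn
  have hp0 : 0 ≤ (p n : ℝ) := (p n).2.1
  have h1 : (n : ℝ) / 2 ≤ (n + 1 - k : ℕ) := by
    rw [div_le_iff₀ (by norm_num)]
    exact_mod_cast (by omega : n ≤ (n + 1 - k) * 2)
  rw [← mul_assoc]
  gcongr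
  calc ((2 : ℝ) ^ k * k.factorial)⁻¹ * (n : ℝ) ^ k = ((n : ℝ) / 2) ^ k / k.factorial := by
        rw [div_pow]; field_simp
    _ ≤ ((n + 1 - k : ℕ) : ℝ) ^ k / k.factorial := by gcongr
    _ ≤ _ := Nat.pow_le_choose k n

/-- The number of `m`-cliques of `G(n, p)` is concentrated once its expectation tends to infinity. -/
theorem tendsto_measure_card_cliques_far {p : ℕ → I} {m : ℕ} (hm : 2 ≤ m) {ε : ℝ}
    (hε : 0 < ε)
    (h : Tendsto (fun n : ℕ => (n.choose m : ℝ) * (p n : ℝ) ^ m.choose 2) atTop atTop) :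
    Tendsto (fun n : ℕ => (binomialRandom (Fin n) (p n)).real
      {G | ε * ((n.choose m : ℝ) * (p n : ℝ) ^ m.choose 2) ≤
        |((cliques m G).card : ℝ) - (n.choose m : ℝ) * (p n : ℝ) ^ m.choose 2|}) atTop (𝓝 0) := by
  have hlim : Tendsto (fun n : ℕ => (∑ k ∈ Finset.Icc 2 m, (m.choose k : ℝ) ^ 2 *
      ((n.choose k : ℝ) * (p n : ℝ) ^ k.choose 2)⁻¹) * (ε ^ 2)⁻¹) atTop (𝓝 0) := by
    rw [← zero_mul (ε ^ 2)⁻¹, ← Finset.sum_const_zero (s := Finset.Icc 2 m)]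
    refine (tendsto_finsetSum _ fun k hk => ?_).mul_const _
    obtain ⟨h2, hkm⟩ := Finset.mem_Icc.1 hk
    rw [← mul_zero ((m.choose k : ℝ) ^ 2)]
    exact (tendsto_inv_atTop_zero.comp
      (tendsto_choose_mul_pow (by omega) hkm h)).const_mul _
  refine squeeze_zero' (Eventually.of_forall fun _ => measureReal_nonneg) ?_ hlim
  filter_upwards [h.eventually_gt_atTop 0, eventually_ge_atTop m] with n hn hmn
  have hp : 0 < (p n : ℝ) := by
    refine (p n).2.1.lt_of_ne' fun hp0 => ?_
    rw [hp0, zero_pow (Nat.choose_pos hm).ne', mul_zero] at hn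
    exact lt_irrefl _ hn
  have : MeasurableSingletonClass (SimpleGraph (Fin n)) :=
    ⟨fun _ => measurableSet_simpleGraph _⟩
  have : Finite (SimpleGraph (Fin n)) := Finite.of_injective _ edgeSet_injective
  have hvar := variance_card_cliques_le (V := Fin n) (p n) hp (m := m) (by simpa using hmn)
  rw [Fintype.card_fin] at hvar
  have hcheb := ProbabilityTheory.meas_ge_le_variance_div_sq (μ := binomialRandom (Fin n) (p n))
    (X := fun G => ((cliques m G).card : ℝ)) MemLp.of_discrete (mul_pos hε hn)
  rw [integral_card_cliques, Fintype.card_fin] at hcheb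
  set L := (n.choose m : ℝ) * (p n : ℝ) ^ m.choose 2
  set R := ∑ k ∈ Finset.Icc 2 m, (m.choose k : ℝ) ^ 2 *
      ((n.choose k : ℝ) * (p n : ℝ) ^ k.choose 2)⁻¹
  refine (ENNReal.toReal_le_of_le_ofReal
    (div_nonneg (ProbabilityTheory.variance_nonneg _ _) (sq_nonneg _)) hcheb).trans ?_
  rw [div_le_iff₀ (by positivity)]
  refine hvar.trans (le_of_eq ?_)
  field_simp

end CliqueCount

end RandomTuran

/-! ### Combining the two bounds, and the choice of constants -/

namespace RandomTuran

open SimpleGraph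

theorem maxCopies_top_eq_card_cliques {α V : Type*} [Fintype α] [DecidableEq α] {m : ℕ}
    {H : SimpleGraph V} {G : SimpleGraph α} (hfree : H.Free (cliqueGraph m G)) :
    maxCopies G (⊤ : SimpleGraph (Fin m)) H = (cliques m G).card := by
  classical
  refine le_antisymm (Finset.sup_le fun G' hG' => ?_) ?_
  · rw [copyCount_top_eq_card_cliques]
    refine Finset.card_le_card fun K hK => ?_
    exact mem_cliques.2 ((mem_cliques.1 hK).mono (Finset.mem_filter.1 hG').2.1)
  · have hcliques : (cliques m G).card =
        (cliqueGraph m G).copyCount (⊤ : SimpleGraph (Fin m)) := by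
      rw [copyCount_top_eq_card_cliques]
      congr 1
      ext K
      rw [mem_cliques, mem_cliques, isNClique_cliqueGraph_iff]
    rw [hcliques, maxCopies]
    refine Finset.le_sup (f := fun G' : SimpleGraph α => G'.copyCount (⊤ : SimpleGraph (Fin m))) ?_
    rw [Finset.mem_filter]
    exact ⟨@Finset.mem_univ _ (_) _, cliqueGraph_le m G, hfree⟩

theorem whpAsymp_of_eventually_exists_dense {m : ℕ} (hm : 2 ≤ m) {V : Type*} {H : SimpleGraph V}
    {p : ℕ → unitInterval} {y : ℝ} {C : ℕ}
    (hdense : ∀ (n : ℕ) (G : SimpleGraph (Fin n)), ¬ H.Free (cliqueGraph m G) →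
      ∃ F : Finset (Sym2 (Fin n)), ↑F ⊆ G.edgeSet ∧ (endpoints F).card ≤ C ∧
        ((endpoints F).card : ℝ) + 1 ≤ y * F.card)
    (hp : ∀ᶠ n : ℕ in atTop, (p n : ℝ) ≤ (n : ℝ) ^ (-y))
    (h : Tendsto (fun n : ℕ => (n.choose m : ℝ) * (p n : ℝ) ^ m.choose 2) atTop atTop) :
    WhpAsymp p (fun _ G => (maxCopies G (⊤ : SimpleGraph (Fin m)) H : ℝ))
      (fun n => (n.choose m : ℝ) * (p n : ℝ) ^ m.choose 2) := by
  intro ε hε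
  have hlim : Tendsto (fun n : ℕ => ((C : ℝ) + 1) * 2 ^ (C.choose 2) * (n : ℝ)⁻¹) atTop (𝓝 0) := by
    simpa using (tendsto_inv_atTop_nhds_zero_nat (𝕜 := ℝ)).const_mul
      (((C : ℝ) + 1) * 2 ^ (C.choose 2))
  have hlower := (hlim.add (tendsto_measure_card_cliques_far hm hε h)).const_sub 1
  rw [add_zero, sub_zero] at hlower
  refine tendsto_of_tendsto_of_tendsto_of_le_of_le' hlower tendsto_const_nhds ?_
    (Eventually.of_forall fun n => measureReal_le_one)
  filter_upwards [hp, eventually_ge_atTop 1] with n hpn hn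
  have hbad := binomialRandom_real_exists_dense_le hn (p n) hpn C
  set L := (n.choose m : ℝ) * (p n : ℝ) ^ m.choose 2
  set B₁ : Set (SimpleGraph (Fin n)) := {G | ∃ F : Finset (Sym2 (Fin n)), ↑F ⊆ G.edgeSet ∧
    (endpoints F).card ≤ C ∧ ((endpoints F).card : ℝ) + 1 ≤ y * F.card}
  set B₂ : Set (SimpleGraph (Fin n)) := {G | ε * L ≤ |((cliques m G).card : ℝ) - L|}
  set A : Set (SimpleGraph (Fin n)) :=
    {G | |(maxCopies G (⊤ : SimpleGraph (Fin m)) H : ℝ) - L| ≤ ε * L}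
  -- When the clique graph is `H`-free, `maxCopies` equals the clique count, so failure means a
  -- dense subgraph or a clique count far from its mean.
  have hsub : Aᶜ ⊆ B₁ ∪ B₂ := by
    intro G hG
    by_cases hfree : H.Free (cliqueGraph m G)
    · right
      have hlt : ε * L < |(maxCopies G (⊤ : SimpleGraph (Fin m)) H : ℝ) - L| := not_le.1 hG
      rw [maxCopies_top_eq_card_cliques hfree] at hlt
      exact hlt.le
    · exact Or.inl (hdense n G hfree)
  have hcompl := probReal_compl_eq_one_sub (μ := binomialRandom (Fin n) (p n))
    (measurableSet_simpleGraph A)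
  have hle := (measureReal_mono (μ := binomialRandom (Fin n) (p n)) hsub
    (measure_ne_top _ _)).trans (measureReal_union_le B₁ B₂)
  linarith

end RandomTuran

theorem theorem1p4 (m : ℕ) (hm : 4 ≤ m + 1) (c : ℝ)
    (hc : c < RandomTuran.twoDensity (⊤ : SimpleGraph (Fin m))) :
    ∃ (M : ℕ) (δ : ℝ), 0 < δ ∧
      ∀ (V : Type*) [Fintype V] (H : SimpleGraph V),
        H.chromaticNumber = ((m + 1 : ℕ) : ℕ∞) →
        RandomTuran.twoDensity H < c →
        (∃ H₀ : H.Subgraph,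
          ((H₀.edgeSet.ncard : ℝ) - 1) / ((H₀.verts.ncard : ℝ) - 2) = RandomTuran.twoDensity H ∧
          M < H₀.verts.ncard) →
        ∀ p : ℕ → unitInterval,
          (∀ᶠ n : ℕ in atTop, (p n : ℝ) ≤ (n : ℝ) ^ (-1 / RandomTuran.twoDensity H + δ)) →
          Tendsto (fun n : ℕ => (n.choose m : ℝ) * (p n : ℝ) ^ (m.choose 2)) atTop atTop →
          RandomTuran.WhpAsymp p
            (fun n G => (RandomTuran.maxCopies G (⊤ : SimpleGraph (Fin m)) H : ℝ))
            (fun n => (n.choose m : ℝ) * (p n : ℝ) ^ (m.choose 2)) := by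
  have hm3 : 3 ≤ m := by omega
  have hm0 : (0 : ℝ) < m := by exact_mod_cast (by omega : 0 < m)
  have hcm : c < ((m : ℝ) + 1) / 2 := hc.trans_le (RandomTuran.twoDensity_top_le hm3)
  have hone : ∀ (V : Type _) [Fintype V] (H : SimpleGraph V),
      H.chromaticNumber = ((m + 1 : ℕ) : ℕ∞) → 1 ≤ RandomTuran.twoDensity H := by
    intro V _ H hχ
    classical
    refine RandomTuran.one_le_twoDensity fun hcol => ?_
    have := hcol.chromaticNumber_le
    rw [hχ] at this
    have : m + 1 ≤ 2 := by exact_mod_cast this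
    omega
  rcases le_or_gt c 1 with hc1 | hc1
  · refine ⟨0, 1, one_pos, fun V _ H hχ hHc => ?_⟩
    linarith [hone V H hχ]
  have hc0 : 0 < c := by linarith
  -- The gap between `c` and `(m + 1)/2` is cut into four: `δ` may use `2γ`, and `2γ` remains in
  -- `hyγ`. Using `c` in place of `m₂(H)` keeps all constants independent of `H`.
  obtain ⟨γ, hγ, hγc⟩ : ∃ γ : ℝ, 0 < γ ∧ 1 / c * (((m : ℝ) + 1) / 2) - 1 = 4 * γ := by
    refine ⟨(1 / c * (((m : ℝ) + 1) / 2) - 1) / 4, ?_, by ring⟩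
    have : 1 < 1 / c * (((m : ℝ) + 1) / 2) := by
      rw [one_div, inv_mul_eq_div, one_lt_div hc0]
      exact hcm
    linarith
  obtain ⟨ε, hε, hεγ⟩ : ∃ ε : ℝ, 0 < ε ∧ ε * (c + 1) ≤ γ :=
    ⟨γ / (c + 1), by positivity, by rw [div_mul_cancel₀ _ (by positivity)]⟩
  obtain ⟨δ, hδ, hδγ, hδm, hδε⟩ : ∃ δ : ℝ, 0 < δ ∧ δ ≤ γ ∧
      δ * (((m : ℝ) + 1) / 2) ≤ 2 * γ ∧ δ ≤ ε / 2 := by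
    refine ⟨min γ (min (2 * γ / (((m : ℝ) + 1) / 2)) (ε / 2)), by positivity, min_le_left _ _, ?_,
      (min_le_right _ _).trans (min_le_right _ _)⟩
    rw [← le_div_iff₀ (by positivity)]
    exact (min_le_right _ _).trans (min_le_left _ _)
  -- This secures both `v(H₀) ≥ 3` and `v(H₀) ≥ 6 / ε + 1`.
  obtain ⟨M, hM⟩ := exists_nat_ge (6 / ε + 3)
  refine ⟨M, δ, hδ, fun V _ H hχ hHc ⟨H₀, hH₀, hMH₀⟩ p hp h => ?_⟩
  have hμ := hone V H hχ
  have hμ0 : 0 < RandomTuran.twoDensity H := by linarith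
  have hvM : (M : ℝ) ≤ H₀.verts.ncard := by exact_mod_cast hMH₀.le
  have hε6 : 0 < 6 / ε := by positivity
  have h₀3 : 3 ≤ H₀.verts.ncard := by
    have : (3 : ℝ) ≤ H₀.verts.ncard := by linarith
    exact_mod_cast this
  have hinv : 1 / c ≤ 1 / RandomTuran.twoDensity H := one_div_le_one_div_of_le hμ0 hHc.le
  have hyγ : 2 * γ ≤ (1 / RandomTuran.twoDensity H - δ) * (((m : ℝ) + 1) / 2) - 1 := by
    have := mul_le_mul_of_nonneg_right hinv (by positivity : 0 ≤ ((m : ℝ) + 1) / 2)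
    linarith
  have hy : 0 ≤ 1 / RandomTuran.twoDensity H - δ := by
    by_contra hneg
    have := mul_neg_of_neg_of_pos (not_le.1 hneg) (by positivity : 0 < ((m : ℝ) + 1) / 2)
    linarith
  refine RandomTuran.whpAsymp_of_eventually_exists_dense (by omega)
    (y := 1 / RandomTuran.twoDensity H - δ) (C := Fintype.card (Sym2 V) * m) ?_ ?_ h
  · intro n G hG
    obtain ⟨f⟩ := SimpleGraph.not_free.1 hG
    exact RandomTuran.exists_dense_of_copy hm3 hμ hHc.le hy rfl hδ.le hε hδγ hyγ hεγ hδε H₀ hH₀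
      h₀3 (by linarith) f
  · filter_upwards [hp] with n hn
    rwa [show -(1 / RandomTuran.twoDensity H - δ) = -1 / RandomTuran.twoDensity H + δ by ring]
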